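/- A quadratic field is a number field $K$ with $[K:\mathbb{Q}]=2$. For a quadratic field $K$ and a polynomial $f\in K[z]$ of degree $2$, regard $f$ as a map $\mathbb{P}^1(K)\to\mathbb{P}^1(K)$, where $\mathbb{P}^1(K)=K\cup\{\infty\}$ and $f(\infty)=\infty$, and let $\operatorname{PrePer}(f,K)$ be the set of points $P\in\mathbb{P}^1(K)$ whose orbit $\{f^m(P):m\ge 0\}$ is finite (so $\infty\in\operatorname{PrePer}(f,K)$). Regard $\operatorname{PrePer}(f,K)$ as a directed graph, with an edge $P\to f(P)$ for every $P\in\operatorname{PrePer}(f,K)$ and no other edges. Suppose that there exists a constant $N\in\mathbb{N}$ such that $\#\operatorname{PrePer}(f,K)\le N$ for every quadratic field $K$ and every quadratic polynomial $f$ with coefficients in $K$. Then $N\ge 15$. Moreover (without any assumption), there are at least $46$ pairwise non-isomorphic finite directed graphs that arise, up to isomorphism, as the directed graph $\operatorname{PrePer}(f,K)$ for some quadratic field $K$ and some quadratic polynomial $f\in K[z]$. -/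

import Mathlib

open Polynomial

/-- Two directed graphs (loops allowed) are isomorphic if there is a bijection between their
vertex sets that preserves and reflects edges. -/
def Digraph.IsIsomorphic {V W : Type*} (G : Digraph V) (H : Digraph W) : Prop :=
  Nonempty (G.Adj ≃r H.Adj)

namespace QuadraticDynamics

/-- The self-map of the projective line `ℙ¹(K) = K ∪ {∞}` (Mathlib's `OnePoint K`, see
`OnePoint.equivProjectivization`) induced by a non-constant polynomial `f` over `K`:
it sends `x` to `f(x)` for `x ∈ K`, and it fixes `∞`. -/
def projMap {K : Type*} [Field K] (f : K[X]) : OnePoint K → OnePoint K :=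
  OnePoint.map (fun x : K => f.eval x)

/-- The set `PrePer(f, K)` of all points of `ℙ¹(K)` whose forward orbit
`{f^m(P) : m ≥ 0}` under `f` is finite. It contains the point `∞`. -/
def prePer {K : Type*} [Field K] (f : K[X]) : Set (OnePoint K) :=
  {P | (Set.range fun m : ℕ => (projMap f)^[m] P).Finite}

/-- The directed graph on `PrePer(f, K)`, with an edge from `P` to `f(P)` for every `P` in
`PrePer(f, K)`, and no other edges. -/
def prePerGraph {K : Type*} [Field K] (f : K[X]) : Digraph (prePer f) where
  Adj P Q := projMap f P = Q

/-- A directed graph arises from `PrePer(f, K)` for some quadratic number field `K` and some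
quadratic polynomial `f` with coefficients in `K`. -/
def Arises {V : Type*} (G : Digraph V) : Prop :=
  ∃ (K : Type) (_ : Field K) (_ : NumberField K) (f : K[X]),
    Module.finrank ℚ K = 2 ∧ f.natDegree = 2 ∧ G.IsIsomorphic (prePerGraph f)

end QuadraticDynamics

/-! Both claims follow from 46 explicit maps z^2 + c over fields ℚ(√D), whose preperiodic points are
determined completely. If q^2 c is integral, then qx is integral for every preperiodic x
(`isIntegral_of_finite_orbit`), so x = (s + t√D)/(2q) with integers s, t. If |c| ≤ B^2 - B at a
complex embedding, with B ≥ 1, then |x| ≤ B there (`norm_le_of_finite_orbit`). Hence only a finite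
box of pairs (s, t) remains, and a kernel computation shows that each pair is listed or has an orbit
that leaves the integral pairs in the box. Conversely, a finite list closed under the map is
preperiodic (`Certificate.Valid.range_vertex`). The graphs are told apart by counting pairs of
vertices whose iterates coincide, which is invariant under isomorphism. A map with 14 finite
preperiodic points, together with ∞, gives N ≥ 15. -/

namespace QuadraticDynamics

/-! ### Preperiodic points of z^2 + c: archimedean bound and integrality. -/

section Field

variable {K : Type*} [Field K]

lemma projMap_iterate_coe (f : K[X]) (m : ℕ) (x : K) :
    (projMap f)^[m] (x : OnePoint K) = ((fun y => f.eval y)^[m] x : K) := by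
  induction m generalizing x with
  | zero => rfl
  | succ m ih => rw [Function.iterate_succ_apply, Function.iterate_succ_apply, ← ih]; rfl

lemma coe_mem_prePer_iff (f : K[X]) (x : K) :
    (x : OnePoint K) ∈ prePer f ↔ (Set.range fun m : ℕ => (fun y => f.eval y)^[m] x).Finite := by
  have h : (Set.range fun m : ℕ => (projMap f)^[m] (x : OnePoint K)) =
      (fun y : K => (y : OnePoint K)) '' Set.range fun m : ℕ => (fun y => f.eval y)^[m] x := by
    rw [← Set.range_comp]
    exact congrArg Set.range (funext fun m => projMap_iterate_coe f m x)
  rw [prePer, Set.mem_ofPred_eq, h]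
  exact Set.finite_image_iff OnePoint.coe_injective.injOn

/-- A finite set that is mapped to itself consists of preperiodic points. -/
lemma mem_prePer_of_mapsTo {f : K[X]} {s : Set (OnePoint K)} (hs : s.Finite)
    (h : Set.MapsTo (projMap f) s s) {P : OnePoint K} (hP : P ∈ s) : P ∈ prePer f :=
  hs.subset (Set.range_subset_iff.2 fun m => h.iterate m hP)

/-- The image of a preperiodic point is preperiodic. -/
lemma projMap_mem_prePer {f : K[X]} {P : OnePoint K} (hP : P ∈ prePer f) :
    projMap f P ∈ prePer f :=
  hP.subset (Set.range_subset_iff.2 fun m => ⟨m + 1, Function.iterate_succ_apply _ _ _⟩)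

/-- Preperiodic points of `z ^ 2 + c` are bounded at every complex embedding. -/
lemma norm_le_of_finite_orbit (σ : K →+* ℂ) {c x : K} {B : ℝ} (hB : 1 ≤ B)
    (hc : ‖σ c‖ ≤ B ^ 2 - B)
    (hx : (Set.range fun m : ℕ => (fun y : K => y ^ 2 + c)^[m] x).Finite) : ‖σ x‖ ≤ B := by
  -- Take an orbit point y of maximal absolute value: |y| > B would give |y^2 + c| ≥ |y|^2 - (B^2 -
  -- B) > |y|.
  obtain ⟨_, ⟨m, rfl⟩, hm⟩ := Set.exists_max_image _ (fun y => ‖σ y‖) hx ⟨x, 0, rfl⟩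
  by_contra! hlt
  have h0 : ‖σ x‖ ≤ ‖σ ((fun y : K => y ^ 2 + c)^[m] x)‖ := hm x ⟨0, rfl⟩
  have h1 := hm _ ⟨m + 1, rfl⟩
  simp only [Function.iterate_succ_apply'] at h1
  set y := (fun y : K => y ^ 2 + c)^[m] x
  have h2 : ‖σ y‖ ^ 2 - ‖σ c‖ ≤ ‖σ (y ^ 2 + c)‖ := by
    rw [map_add, map_pow, ← norm_pow, sub_le_iff_le_add]
    calc ‖σ y ^ 2‖ = ‖(σ y ^ 2 + σ c) - σ c‖ := by congr 1; ring
      _ ≤ _ := norm_sub_le _ _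
  nlinarith

/-- If `q ^ 2 * c` is integral, then `q * x` is integral for every preperiodic point `x` of
`z ^ 2 + c`. -/
lemma isIntegral_of_finite_orbit {c x : K} {q : ℤ} (hc : IsIntegral ℤ ((q : K) ^ 2 * c))
    (hx : (Set.range fun m : ℕ => (fun y : K => y ^ 2 + c)^[m] x).Finite) :
    IsIntegral ℤ ((q : K) * x) := by
  set g : K → K := fun y => y ^ 2 + c with hg
  -- The recursion is P_{m+1} = P_m^2 + q^(2^(m+1) - 2) · (q^2 c), starting from P_0 = X.
  have key : ∀ m : ℕ, ∃ P : (integralClosure ℤ K)[X], P.Monic ∧ P.natDegree = 2 ^ m ∧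
      aeval ((q : K) * x) P = (q : K) ^ 2 ^ m * g^[m] x := by
    intro m
    induction m with
    | zero => exact ⟨X, monic_X, by simp, by simp⟩
    | succ m ih =>
      obtain ⟨P, hP, hd, he⟩ := ih
      let a : integralClosure ℤ K := ⟨(q : K) ^ 2 * c, hc⟩
      have hd2 : (P ^ 2).natDegree = 2 ^ (m + 1) := by rw [hP.natDegree_pow, hd, pow_succ']
      obtain ⟨k, hk⟩ : ∃ k, 2 ^ (m + 1) = k + 2 :=
        ⟨2 ^ (m + 1) - 2, by have := Nat.one_le_two_pow (n := m); rw [pow_succ]; omega⟩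
      have hpos : (C ((q : integralClosure ℤ K) ^ k * a)).degree < (P ^ 2).degree := by
        rw [degree_eq_natDegree (hP.pow 2).ne_zero, hd2]
        exact degree_C_le.trans_lt (by exact_mod_cast Nat.two_pow_pos _)
      refine ⟨P ^ 2 + C ((q : integralClosure ℤ K) ^ k * a),
        (hP.pow 2).add_of_left hpos, ?_, ?_⟩
      · rw [natDegree_eq_of_degree_eq (degree_add_eq_left_of_degree_lt hpos), hd2]
      · have ha : algebraMap (integralClosure ℤ K) K a = (q : K) ^ 2 * c := rfl
        rw [Function.iterate_succ_apply', map_add, map_pow, he, aeval_C, map_mul, map_pow,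
          map_intCast, ha, hg, ← mul_assoc, ← pow_add, ← hk]
        ring
  obtain ⟨m, n, hmn, h⟩ : ∃ m n, m < n ∧ g^[m] x = g^[n] x := by
    have : ¬ Function.Injective fun m : ℕ => g^[m] x := fun hi =>
      Set.infinite_range_of_injective hi hx
    rw [Function.Injective] at this
    push Not at this
    obtain ⟨m, n, h, hne⟩ := this
    rcases lt_or_gt_of_ne hne with hlt | hlt
    exacts [⟨m, n, hlt, h⟩, ⟨n, m, hlt, h.symm⟩]
  obtain ⟨P, hP, hPd, hPe⟩ := key m
  obtain ⟨Q, hQ, hQd, hQe⟩ := key n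
  have hlt : 2 ^ m < 2 ^ n := Nat.pow_lt_pow_right one_lt_two hmn
  have : IsIntegral (integralClosure ℤ K) ((q : K) * x) := by
    -- A collision of the m-th and n-th iterates makes qx a root of the monic polynomial P_n -
    -- q^(2^n - 2^m) P_m.
    refine ⟨Q - C ((q : integralClosure ℤ K) ^ (2 ^ n - 2 ^ m)) * P, hQ.sub_of_left ?_, ?_⟩
    · exact degree_lt_degree ((natDegree_C_mul_le _ _).trans_lt (by rwa [hPd, hQd]))
    · rw [← aeval_def, map_sub, map_mul, aeval_C, hPe, hQe, map_pow, map_intCast, ← mul_assoc,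
        ← pow_add, Nat.sub_add_cancel hlt.le, h, sub_self]
  exact isIntegral_trans _ this

end Field

/-! ### Arithmetic of ℚ(√D). -/

section Quadratic

variable {D : ℤ}

/-- The term `0 * r` matches the shape of the hypothesis that makes `QuadraticAlgebra ℚ D 0` a
field. -/
lemma sq_ne_of_squarefree (hD : Squarefree D) (h1 : D ≠ 1) (r : ℚ) :
    r ^ 2 ≠ (D : ℚ) + 0 * r := by
  intro h
  obtain ⟨n, rfl⟩ : ∃ n : ℤ, (n : ℚ) = r := by
    have : IsIntegral ℤ r := ⟨X ^ 2 - C D, monic_X_pow_sub_C _ two_ne_zero, by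
      rw [eval₂_sub, eval₂_X_pow, eval₂_C, h]; simp⟩
    exact IsIntegrallyClosed.isIntegral_iff.1 this
  have h2 : n * n = D := by
    have : (n : ℚ) * n = D := by linear_combination h
    exact_mod_cast this
  have := Int.isUnit_iff.1 (hD n (h2 ▸ dvd_rfl))
  rcases this with rfl | rfl <;> simp at h2 <;> exact h1 h2.symm

/-- A rational number whose square becomes integral after multiplication by a squarefree integer
is an integer. -/
lemma exists_int_of_squarefree_mul_sq (hD : Squarefree D) {v : ℚ} {m : ℤ}
    (h : (D : ℚ) * v ^ 2 = m) : ∃ t : ℤ, (t : ℚ) = v := by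
  have h1 : D * v.num ^ 2 = m * (v.den : ℤ) ^ 2 := by
    have hd : (v.den : ℚ) ≠ 0 := by exact_mod_cast v.den_ne_zero
    have : (D : ℚ) * v.num ^ 2 = m * (v.den : ℚ) ^ 2 := by
      rw [← h]; nth_rewrite 2 [← Rat.num_div_den v]; field_simp
    exact_mod_cast this
  have hcop : IsCoprime ((v.den : ℤ) * v.den) (v.num ^ 2) := by
    have : IsCoprime (v.den : ℤ) v.num :=
      (Int.isCoprime_iff_gcd_eq_one.2 (by simpa [Int.gcd] using v.reduced)).symm
    exact (this.mul_left this).pow_right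
  have hdvd : (v.den : ℤ) * v.den ∣ D :=
    hcop.dvd_of_dvd_mul_right (h1 ▸ ⟨m, by ring⟩)
  have h2 : v.den = 1 := by simpa using Int.isUnit_iff_natAbs_eq.1 (hD _ hdvd)
  exact ⟨v.num, (Rat.den_eq_one_iff v).1 h2⟩

instance [Fact (∀ r : ℚ, r ^ 2 ≠ (D : ℚ) + 0 * r)] :
    NumberField (QuadraticAlgebra ℚ (D : ℚ) 0) where
  to_charZero := inferInstance
  to_finiteDimensional := by
    convert (inferInstance : Module.Finite ℚ (QuadraticAlgebra ℚ (D : ℚ) 0))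

lemma finrank_quadraticAlgebra [Fact (∀ r : ℚ, r ^ 2 ≠ (D : ℚ) + 0 * r)] :
    Module.finrank ℚ (QuadraticAlgebra ℚ (D : ℚ) 0) = 2 := by
  convert QuadraticAlgebra.finrank_eq_two (D : ℚ) 0

/-- The embedding of `ℚ(√D)` into the complex numbers that sends `√D` to the given root. -/
noncomputable def embedding (δ : ℂ) (hδ : δ * δ = D) : QuadraticAlgebra ℚ (D : ℚ) 0 →+* ℂ :=
  (QuadraticAlgebra.lift ⟨δ, by simp [hδ, Algebra.smul_def]⟩ :
    QuadraticAlgebra ℚ (D : ℚ) 0 →ₐ[ℚ] ℂ).toRingHom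

lemma embedding_mk (δ : ℂ) (hδ : δ * δ = D) (u v : ℚ) :
    embedding δ hδ ⟨u, v⟩ = u + v * δ := by
  simp [embedding, QuadraticAlgebra.lift, Algebra.smul_def]

/-- Trace and norm give integers s = 2u and N = u^2 - D v^2, so D (2v)^2 = s^2 - 4N is an integer
and squarefreeness of D applies. Parity conditions on s and t are not needed, as a superset of the
candidates suffices. -/
lemma exists_int_of_isIntegral (hD : Squarefree D) {u v : ℚ}
    (h : IsIntegral ℤ (⟨u, v⟩ : QuadraticAlgebra ℚ (D : ℚ) 0)) :
    ∃ s t : ℤ, (s : ℚ) = 2 * u ∧ (t : ℚ) = 2 * v := by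
  have hstar : IsIntegral ℤ (⟨u, -v⟩ : QuadraticAlgebra ℚ (D : ℚ) 0) := by
    have := h.map (starRingEnd (QuadraticAlgebra ℚ (D : ℚ) 0)).toIntAlgHom
    convert this using 1
    ext <;> simp [starRingEnd_apply]
  have hrat : ∀ r : ℚ, IsIntegral ℤ (⟨r, 0⟩ : QuadraticAlgebra ℚ (D : ℚ) 0) →
      ∃ n : ℤ, (n : ℚ) = r := fun r hr =>
    IsIntegrallyClosed.isIntegral_iff.1
      ((isIntegral_algebraMap_iff (QuadraticAlgebra.algebraMap_injective
        (a := (D : ℚ)) (b := 0))).1 hr)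
  obtain ⟨s, hs⟩ := hrat (2 * u) (by
    convert h.add hstar using 1
    refine QuadraticAlgebra.ext ?_ ?_ <;> simp [two_mul])
  obtain ⟨N, hN⟩ := hrat (u ^ 2 - D * v ^ 2) (by
    convert h.mul hstar using 1
    refine QuadraticAlgebra.ext ?_ ?_ <;> simp <;> ring)
  obtain ⟨t, ht⟩ := exists_int_of_squarefree_mul_sq hD (v := 2 * v) (m := s ^ 2 - 4 * N) (by
    push_cast
    rw [hs, hN]
    ring)
  exact ⟨s, t, hs, ht⟩

end Quadratic

/-! ### Certificates and their soundness. -/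

/-- A certificate for the preperiodic points over `ℚ(√D)` of the polynomial
`z ^ 2 + (α + β √D) / (2 q ^ 2)`. The pair `(s, t)` stands for the number `(s + t √D) / (2 q)`.
The list `pts` contains the finite preperiodic points, and `next` describes the action on the list
that consists of `∞` followed by `pts`. All preperiodic points have `|s| ≤ M` and `|t| ≤ T`. -/
structure Certificate where
  D : ℤ
  q : ℤ
  α : ℤ
  β : ℤ
  r : ℕ
  M : ℕ
  T : ℕ
  pts : List (ℤ × ℤ)
  next : List ℕ

namespace Certificate

/-- The action of the polynomial on pairs, as far as the image is again a pair of integers. -/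
def step (c : Certificate) (p : ℤ × ℤ) : Option (ℤ × ℤ) :=
  if (p.1 * p.1 + c.D * (p.2 * p.2) + 2 * c.α) % (2 * c.q) = 0 ∧
      (p.1 * p.2 + c.β) % c.q = 0 then
    some ((p.1 * p.1 + c.D * (p.2 * p.2) + 2 * c.α) / (2 * c.q), (p.1 * p.2 + c.β) / c.q)
  else none

def inBox (c : Certificate) (p : ℤ × ℤ) : Bool :=
  Nat.ble p.1.natAbs c.M && Nat.ble p.2.natAbs c.T

/-- The orbit of the pair leaves the set of integral pairs in the box after at most `k` steps. -/
def escapes (c : Certificate) : ℕ → ℤ × ℤ → Bool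
  | 0, _ => false
  | k + 1, p =>
    match c.step p with
    | none => true
    | some p' => !c.inBox p' || c.escapes k p'

def vertices (c : Certificate) : List (Option (ℤ × ℤ)) := none :: c.pts.map some

def stepVertex (c : Certificate) : Option (ℤ × ℤ) → Option (Option (ℤ × ℤ))
  | none => some none
  | some p => (c.step p).map some

/-- With B = M/(2q), the second group says that q^2 c has integral norm, that r bounds √|D| (unless
β = 0), that |c| ≤ B^2 - B and B ≥ 1, and that |t|√|D| ≤ M forces |t| ≤ T. The last clause searches
the whole box. -/
def Valid (c : Certificate) : Prop :=
  (0 < c.q ∧ c.D ≠ 0 ∧ c.D ≠ 1 ∧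
    ∀ d ∈ List.range (c.D.natAbs + 1), 2 ≤ d → c.D.natAbs % (d * d) ≠ 0) ∧
  ((c.α ^ 2 - c.D * c.β ^ 2) % 4 = 0 ∧ (c.D.natAbs ≤ c.r ^ 2 ∨ c.β = 0) ∧
    2 * ((c.α.natAbs : ℤ) + c.β.natAbs * c.r) ≤ c.M ^ 2 - 2 * c.q * c.M ∧ 2 * c.q ≤ c.M ∧
    c.M ^ 2 < c.D.natAbs * (c.T + 1) ^ 2) ∧
  (c.pts.Nodup ∧ (c.next.map fun j => c.vertices[j]?) = c.vertices.map c.stepVertex ∧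
    ∀ j ∈ c.next, j < c.next.length) ∧
  ∀ i ∈ List.range (2 * c.M + 1), ∀ j ∈ List.range (2 * c.T + 1),
    (c.escapes 4 ((i : ℤ) - c.M, (j : ℤ) - c.T) ||
      c.pts.contains ((i : ℤ) - c.M, (j : ℤ) - c.T)) = true

instance (c : Certificate) : Decidable c.Valid := by
  unfold Valid
  infer_instance

lemma length_vertices (c : Certificate) : c.vertices.length = c.pts.length + 1 := by
  simp [vertices]

/-- The self-map of the set of indices that is described by the list `next`. -/
def nextFin (c : Certificate) (i : Fin (c.pts.length + 1)) : Fin (c.pts.length + 1) :=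
  -- For a valid certificate neither the default 0 nor the reduction takes effect; they only make
  -- the map total.
  ⟨c.next.getD i 0 % (c.pts.length + 1), Nat.mod_lt _ (Nat.succ_pos _)⟩

def graph (c : Certificate) : Digraph (Fin (c.pts.length + 1)) where
  Adj i j := c.nextFin i = j

lemma Valid.squarefree {c : Certificate} (h : c.Valid) : Squarefree c.D := by
  rw [← Int.squarefree_natAbs]
  intro d hd
  have h0 : c.D.natAbs ≠ 0 := Int.natAbs_ne_zero.2 h.1.2.1
  have hle : d ≤ c.D.natAbs :=
    (Nat.le_of_dvd (Nat.pos_of_ne_zero h0) ((dvd_mul_right d d).trans hd))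
  have := h.1.2.2.2 d (List.mem_range.2 (Nat.lt_succ_of_le hle))
  have h2 : ¬ 2 ≤ d := fun h2 => this h2 (Nat.mod_eq_zero_of_dvd hd)
  have h3 : d ≠ 0 := by rintro rfl; exact h0 (by simpa using hd)
  exact Nat.isUnit_iff.2 (by omega)

lemma Valid.sq_ne {c : Certificate} (h : c.Valid) :
    Fact (∀ r : ℚ, r ^ 2 ≠ (c.D : ℚ) + 0 * r) :=
  ⟨sq_ne_of_squarefree h.squarefree h.1.2.2.1⟩

/-- The quadratic field. -/
abbrev Fld (c : Certificate) : Type := QuadraticAlgebra ℚ (c.D : ℚ) 0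

def param (c : Certificate) : c.Fld := ⟨c.α / (2 * c.q ^ 2), c.β / (2 * c.q ^ 2)⟩

def point (c : Certificate) (p : ℤ × ℤ) : c.Fld := ⟨p.1 / (2 * c.q), p.2 / (2 * c.q)⟩

lemma Valid.q_ne_zero {c : Certificate} (h : c.Valid) : (c.q : ℚ) ≠ 0 := by
  exact_mod_cast h.1.1.ne'

lemma Valid.point_injective {c : Certificate} (h : c.Valid) : Function.Injective c.point := by
  intro p p' hp
  have hq := h.q_ne_zero
  simp only [point, QuadraticAlgebra.mk.injEq] at hp
  obtain ⟨h1, h2⟩ := hp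
  field_simp at h1 h2
  exact Prod.ext (by exact_mod_cast h1) (by exact_mod_cast h2)

/-- Clearing denominators leaves two integer equations; `none` thus means that the image is not
represented by an integral pair. -/
lemma Valid.step_eq_some_iff {c : Certificate} (h : c.Valid) (p p' : ℤ × ℤ) :
    c.step p = some p' ↔ c.point p ^ 2 + c.param = c.point p' := by
  have hq := h.q_ne_zero
  have hq' : c.q ≠ 0 := h.1.1.ne'
  have key : c.point p ^ 2 + c.param = c.point p' ↔
      p.1 * p.1 + c.D * (p.2 * p.2) + 2 * c.α = 2 * c.q * p'.1 ∧
        p.1 * p.2 + c.β = c.q * p'.2 := by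
    rw [QuadraticAlgebra.ext_iff]
    refine and_congr ?_ ?_
    · simp only [point, param, sq, QuadraticAlgebra.re_add, QuadraticAlgebra.re_mul]
      rw [← @Int.cast_inj ℚ]
      push_cast
      field_simp
    · simp only [point, param, sq, QuadraticAlgebra.im_add, QuadraticAlgebra.im_mul]
      rw [← @Int.cast_inj ℚ]
      push_cast
      field_simp
      constructor <;> intro h <;> linarith
  rw [key, step]
  split_ifs with hd
  · rw [Option.some_inj, Prod.ext_iff]
    refine and_congr ?_ ?_
    · rw [Int.ediv_eq_iff_eq_mul_right (by positivity) (Int.dvd_of_emod_eq_zero hd.1)]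
    · rw [Int.ediv_eq_iff_eq_mul_right hq' (Int.dvd_of_emod_eq_zero hd.2)]
  · refine iff_of_false (by simp) fun ⟨h1, h2⟩ => hd ?_
    rw [h1, h2]
    simp

/-- The point of the projective line that is described by a vertex. -/
def vertexPoint (c : Certificate) : Option (ℤ × ℤ) → OnePoint c.Fld := Option.map c.point

def vertex (c : Certificate) (i : Fin (c.pts.length + 1)) : OnePoint c.Fld :=
  c.vertexPoint (c.vertices[i]'(by have := c.length_vertices; omega))

lemma Valid.vertex_injective {c : Certificate} (h : c.Valid) : Function.Injective c.vertex := by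
  have h1 : c.vertices.Nodup := by
    rw [vertices, List.nodup_cons]
    exact ⟨by simp, h.2.2.1.1.map (Option.some_injective _)⟩
  intro i j hij
  have := Option.map_injective h.point_injective hij
  exact Fin.ext ((h1.getElem_inj_iff).1 this)

section

variable {c : Certificate} [Fact (∀ r : ℚ, r ^ 2 ≠ (c.D : ℚ) + 0 * r)]

variable (c) in
noncomputable def poly : c.Fld[X] := X ^ 2 + C c.param

lemma eval_poly (x : c.Fld) : c.poly.eval x = x ^ 2 + c.param := by simp [poly]

lemma finite_orbit {x : c.Fld} (hx : (x : OnePoint c.Fld) ∈ prePer c.poly) :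
    (Set.range fun m : ℕ => (fun y : c.Fld => y ^ 2 + c.param)^[m] x).Finite := by
  simpa only [coe_mem_prePer_iff, eval_poly] using hx

lemma Valid.isIntegral_param (h : c.Valid) :
    IsIntegral ℤ (((c.q : ℤ) : c.Fld) ^ 2 * c.param) := by
  have hq := h.q_ne_zero
  obtain ⟨N, hN⟩ := Int.dvd_of_emod_eq_zero h.2.1.1
  have hN' : (c.α : ℚ) ^ 2 - c.D * c.β ^ 2 = 4 * N := by exact_mod_cast hN
  have he : ((c.q : ℤ) : c.Fld) ^ 2 * c.param = ⟨c.α / 2, c.β / 2⟩ := by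
    refine QuadraticAlgebra.ext ?_ ?_ <;> simp [param, sq] <;> field_simp
  rw [he]
  -- The number (α + β√D)/2 has trace α and norm N.
  refine ⟨X ^ 2 + (-C c.α * X + C N), ?_, ?_⟩
  · refine (monic_X_pow 2).add_of_left ?_
    rw [← C_neg, degree_X_pow]
    exact degree_linear_lt
  · simp only [eval₂_add, eval₂_mul, eval₂_neg, eval₂_pow, eval₂_X, eval₂_C]
    refine QuadraticAlgebra.ext ?_ ?_ <;> simp [sq]
    · linear_combination (-1 / 4 : ℚ) * hN'
    · ring

lemma Valid.exists_point (h : c.Valid) {x : c.Fld}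
    (hx : (x : OnePoint c.Fld) ∈ prePer c.poly) :
    ∃ p, c.point p = x ∧ c.inBox p = true := by
  have hq := h.q_ne_zero
  have hq0 : (0 : ℝ) < c.q := by exact_mod_cast h.1.1
  have horb := finite_orbit hx
  obtain ⟨u, v⟩ := x
  obtain ⟨s, t, hs, ht⟩ : ∃ s t : ℤ, (s : ℚ) = 2 * (c.q * u) ∧ (t : ℚ) = 2 * (c.q * v) := by
    refine exists_int_of_isIntegral h.squarefree ?_
    have he : ((c.q : ℤ) : c.Fld) * ⟨u, v⟩ = ⟨c.q * u, c.q * v⟩ := by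
      refine QuadraticAlgebra.ext ?_ ?_ <;> simp
    exact he ▸ isIntegral_of_finite_orbit h.isIntegral_param horb
  have hu : u = s / (2 * c.q) := by rw [hs]; field_simp
  have hv : v = t / (2 * c.q) := by rw [ht]; field_simp
  obtain ⟨δ, hδ⟩ := IsAlgClosed.exists_pow_nat_eq (c.D : ℂ) two_pos
  obtain ⟨-, ⟨-, hr, hM, hqM, hT⟩, -⟩ := h
  have hnδ : ‖δ‖ ^ 2 = c.D.natAbs := by
    rw [← norm_pow, hδ, Complex.norm_intCast, Nat.cast_natAbs, Int.cast_abs]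
  have hMr : 2 * (|(c.α : ℝ)| + |(c.β : ℝ)| * c.r) ≤ c.M ^ 2 - 2 * c.q * c.M := by
    have : ((2 * ((c.α.natAbs : ℤ) + c.β.natAbs * c.r) : ℤ) : ℝ) ≤
        ((c.M ^ 2 - 2 * c.q * c.M : ℤ) : ℝ) := Int.cast_le.2 hM
    simpa using this
  have hβ : |(c.β : ℝ)| * ‖δ‖ ≤ |(c.β : ℝ)| * c.r := by
    rcases hr with hr | hr
    · refine mul_le_mul_of_nonneg_left (le_of_sq_le_sq ?_ (by positivity)) (abs_nonneg _)
      rw [hnδ]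
      exact_mod_cast hr
    · simp [hr]
  have hqM' : 2 * (c.q : ℝ) ≤ c.M := by exact_mod_cast hqM
  have bound : ∀ ε : ℂ, ε * ε = c.D → ‖ε‖ = ‖δ‖ → ‖(s : ℂ) + t * ε‖ ≤ c.M := by
    intro ε hε hεδ
    have h1 : ‖embedding ε hε c.param‖ ≤
        ((c.M : ℝ) / (2 * c.q)) ^ 2 - (c.M : ℝ) / (2 * c.q) := by
      have e1 : embedding ε hε c.param = (c.α + c.β * ε) / (2 * c.q ^ 2) := by
        rw [param, embedding_mk]; push_cast; ring
      have e2 : ‖(2 * (c.q : ℂ) ^ 2)‖ = 2 * (c.q : ℝ) ^ 2 := by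
        simp
      rw [e1, norm_div, e2, div_le_iff₀ (by positivity)]
      calc ‖(c.α : ℂ) + c.β * ε‖ ≤ |(c.α : ℝ)| + |(c.β : ℝ)| * ‖δ‖ := by
            refine (norm_add_le _ _).trans_eq ?_
            rw [norm_mul, hεδ, Complex.norm_intCast, Complex.norm_intCast]
        _ ≤ (c.M ^ 2 - 2 * c.q * c.M) / 2 := by linarith
        _ = _ := by field_simp
    have h2 := norm_le_of_finite_orbit (embedding ε hε)
      ((one_le_div (by positivity)).2 hqM') h1 horb
    have e3 : embedding ε hε ⟨u, v⟩ = (s + t * ε) / (2 * c.q) := by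
      rw [embedding_mk, hu, hv]; push_cast; ring
    have e4 : ‖(2 * (c.q : ℂ))‖ = 2 * (c.q : ℝ) := by
      simp [hq0.le]
    rw [e3, norm_div, e4] at h2
    exact (div_le_div_iff_of_pos_right (by positivity)).1 h2
  -- Half the sum and half the difference of the two conjugates isolate s and t√D.
  have b1 := bound δ (by rw [← hδ, sq]) rfl
  have b2 := bound (-δ) (by rw [← hδ]; ring) (norm_neg _)
  have hs' : |(s : ℝ)| ≤ c.M := by
    have : ‖(2 : ℂ) * s‖ ≤ c.M + c.M := by
      calc ‖(2 : ℂ) * s‖ = ‖((s : ℂ) + t * δ) + (s + t * (-δ))‖ := by congr 1; ring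
        _ ≤ _ := (norm_add_le _ _).trans (add_le_add b1 b2)
    rw [norm_mul, Complex.norm_intCast, Complex.norm_ofNat] at this
    linarith
  have ht' : |(t : ℝ)| * ‖δ‖ ≤ c.M := by
    have : ‖(2 : ℂ) * (t * δ)‖ ≤ c.M + c.M := by
      calc ‖(2 : ℂ) * (t * δ)‖ = ‖((s : ℂ) + t * δ) - (s + t * (-δ))‖ := by congr 1; ring
        _ ≤ _ := (norm_sub_le _ _).trans (add_le_add b1 b2)
    rw [norm_mul, norm_mul, Complex.norm_intCast, Complex.norm_ofNat] at this
    linarith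
  refine ⟨(s, t), by rw [point, hu, hv], ?_⟩
  rw [inBox, Bool.and_eq_true, Nat.ble_eq, Nat.ble_eq]
  constructor
  · rw [← @Nat.cast_le ℝ, Nat.cast_natAbs, Int.cast_abs]
    exact hs'
  · by_contra! hlt
    have h1 : ((c.T : ℝ) + 1) ≤ |(t : ℝ)| := by
      rw [← Int.cast_abs, ← Nat.cast_natAbs]
      exact_mod_cast hlt
    have h2 : ((c.M : ℝ)) ^ 2 < c.D.natAbs * ((c.T : ℝ) + 1) ^ 2 := by exact_mod_cast hT
    have h3 : (|(t : ℝ)| * ‖δ‖) ^ 2 ≤ (c.M : ℝ) ^ 2 := by gcongr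
    have h4 : ‖δ‖ ^ 2 * ((c.T : ℝ) + 1) ^ 2 ≤ ‖δ‖ ^ 2 * |(t : ℝ)| ^ 2 := by gcongr
    rw [← hnδ] at h2
    nlinarith

/-- The forward orbit of a preperiodic point consists of preperiodic points, which
`Valid.exists_point` puts in the box. -/
lemma Valid.escapes_eq_false (h : c.Valid) (k : ℕ) (p : ℤ × ℤ)
    (hp : (c.point p : OnePoint c.Fld) ∈ prePer c.poly) : c.escapes k p = false := by
  induction k generalizing p with
  | zero => rfl
  | succ k ih =>
    have h1 : ((c.point p ^ 2 + c.param : c.Fld) : OnePoint c.Fld) ∈ prePer c.poly := by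
      rw [← eval_poly]
      exact projMap_mem_prePer hp
    obtain ⟨p', hp', hbox⟩ := h.exists_point h1
    rw [escapes, (h.step_eq_some_iff p p').2 hp'.symm]
    simp [hbox, ih p' (hp' ▸ h1)]

lemma Valid.mem_pts (h : c.Valid) {x : c.Fld}
    (hx : (x : OnePoint c.Fld) ∈ prePer c.poly) : ∃ p ∈ c.pts, c.point p = x := by
  obtain ⟨⟨s, t⟩, rfl, hbox⟩ := h.exists_point hx
  rw [inBox, Bool.and_eq_true, Nat.ble_eq, Nat.ble_eq] at hbox
  -- The search indices are the coordinates shifted by M and T.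
  have := h.2.2.2 (s + c.M).toNat (List.mem_range.2 (by dsimp at hbox; omega))
    (t + c.T).toNat (List.mem_range.2 (by dsimp at hbox; omega))
  have hs : ((s + c.M).toNat : ℤ) - c.M = s := by dsimp at hbox; omega
  have ht : ((t + c.T).toNat : ℤ) - c.T = t := by dsimp at hbox; omega
  rw [hs, ht, h.escapes_eq_false 4 _ hx, Bool.false_or, List.contains_iff_mem] at this
  exact ⟨_, this, rfl⟩

lemma Valid.projMap_vertexPoint (h : c.Valid) {o o' : Option (ℤ × ℤ)}
    (ho : c.stepVertex o = some o') :
    projMap c.poly (c.vertexPoint o) = c.vertexPoint o' := by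
  cases o with
  | none => cases ho; rfl
  | some p =>
    obtain ⟨p', hp', rfl⟩ := Option.map_eq_some_iff.1 ho
    rw [h.step_eq_some_iff, ← eval_poly] at hp'
    exact congrArg some hp'

lemma Valid.projMap_vertex (h : c.Valid) (i : Fin (c.pts.length + 1)) :
    projMap c.poly (c.vertex i) = c.vertex (c.nextFin i) := by
  obtain ⟨-, hmap, hlt⟩ := h.2.2.1
  have hv := c.length_vertices
  have hi' : (i : ℕ) < c.vertices.length := by omega
  have hj' : (c.nextFin i : ℕ) < c.vertices.length := by omega
  have hlen : c.next.length = c.pts.length + 1 := by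
    simpa [hv] using congrArg List.length hmap
  have hi : (i : ℕ) < c.next.length := by omega
  have hn : ((c.nextFin i : Fin _) : ℕ) = c.next[(i : ℕ)] := by
    have := hlt _ (List.getElem_mem hi)
    rw [hlen] at this
    simp only [nextFin, List.getD_eq_getElem _ _ hi]
    exact Nat.mod_eq_of_lt this
  refine h.projMap_vertexPoint ?_
  have h1 := congrArg (fun l => l[(i : ℕ)]?) hmap
  simp only [List.getElem?_map, List.getElem?_eq_getElem hi,
    List.getElem?_eq_getElem hi', Option.map_some] at h1
  rw [← hn, List.getElem?_eq_getElem hj'] at h1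
  exact (Option.some_inj.1 h1).symm

lemma Valid.range_vertex (h : c.Valid) : Set.range c.vertex = prePer c.poly := by
  refine Set.Subset.antisymm ?_ fun P hP => ?_
  · rintro _ ⟨i, rfl⟩
    refine mem_prePer_of_mapsTo (Set.finite_range c.vertex) ?_ ⟨i, rfl⟩
    rintro _ ⟨j, rfl⟩
    exact ⟨_, (h.projMap_vertex j).symm⟩
  · have key : ∀ o ∈ c.vertices, c.vertexPoint o ∈ Set.range c.vertex := by
      intro o ho
      obtain ⟨i, hi, rfl⟩ := List.getElem_of_mem ho
      exact ⟨⟨i, by simpa [vertices] using hi⟩, rfl⟩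
    cases P with
    | infty => exact key none (by simp [vertices])
    | coe x =>
      obtain ⟨p, hp, rfl⟩ := h.mem_pts hP
      exact key (some p) (by simp [vertices, hp])

end

lemma Valid.prePer_encard {c : Certificate} (h : c.Valid)
    [Fact (∀ r : ℚ, r ^ 2 ≠ (c.D : ℚ) + 0 * r)] :
    (prePer c.poly).encard = (c.pts.length + 1 : ℕ) := by
  rw [← h.range_vertex, ← Set.image_univ, h.vertex_injective.encard_image, Set.encard_univ]
  simp

lemma Valid.arises {c : Certificate} (h : c.Valid) : Arises c.graph := by
  have := h.sq_ne
  refine ⟨c.Fld, inferInstance, inferInstance, c.poly, finrank_quadraticAlgebra,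
    natDegree_X_pow_add_C, ⟨?_⟩⟩
  refine ⟨(Equiv.ofInjective _ h.vertex_injective).trans (Equiv.setCongr h.range_vertex), ?_⟩
  intro i j
  change projMap c.poly (c.vertex i) = c.vertex j ↔ c.nextFin i = j
  rw [h.projMap_vertex, h.vertex_injective.eq_iff]

end Certificate

/-! ### Isomorphism invariants and the table. -/

/-- The number of pairs `(x, y)` with `F^[a] x = F^[b] y` and `F^[c] x = F^[d] y`. -/
def coincidences {V : Type*} [Fintype V] [DecidableEq V] (F : V → V) (a b c d : ℕ) : ℕ :=
  (Finset.univ.filter fun p : V × V =>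
    F^[a] p.1 = F^[b] p.2 ∧ F^[c] p.1 = F^[d] p.2).card

lemma coincidences_eq_of_semiconj {V W : Type*} [Fintype V] [DecidableEq V] [Fintype W]
    [DecidableEq W] {F : V → V} {F' : W → W} (e : V ≃ W) (h : Function.Semiconj e F F')
    (a b c d : ℕ) : coincidences F a b c d = coincidences F' a b c d := by
  refine Finset.card_equiv (e.prodCongr e) fun p => ?_
  simp only [Finset.mem_filter, Finset.mem_univ, true_and, Equiv.prodCongr_apply, Prod.map_fst,
    Prod.map_snd, ← (h.iterate_right _).eq, e.injective.eq_iff]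

namespace Certificate

/-- A natural number that depends only on the isomorphism class of the graph: it is assembled
from three of the numbers of coincidences of the self-map. -/
def invariant (c : Certificate) : ℕ :=
  -- Any function of the three counts is invariant, so the packing need not be injective; the
  -- exponents are chosen so that the values separate the table.
  (coincidences c.nextFin 4 4 4 4 * 1000 + coincidences c.nextFin 2 4 4 3) * 1000 +
    coincidences c.nextFin 1 2 1 4

lemma invariant_eq_of_isIsomorphic {c c' : Certificate} (h : c.graph.IsIsomorphic c'.graph) :
    c.invariant = c'.invariant := by
  obtain ⟨e⟩ := h
  have hs : Function.Semiconj e.toEquiv c.nextFin c'.nextFin := fun i =>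
    (e.map_rel_iff.2 (rfl : c.graph.Adj i (c.nextFin i))).symm
  simp only [invariant, coincidences_eq_of_semiconj e.toEquiv hs]

/-- Certificates for 46 graphs of preperiodic points, sorted by their invariants. -/
def table : List Certificate := [
  -- The entries with D = -149 have rational c and only rational finite preperiodic points: this
  -- field adds none.
  ⟨-149, 1, 2, 0, 0, 4, 0, [],
    [0]⟩,
  ⟨-149, 2, 2, 0, 0, 5, 0, [(-2, 0), (2, 0)],
    [0, 2, 2]⟩,
  ⟨-149, 1, -2, 0, 0, 4, 0, [(-2, 0), (0, 0), (2, 0)],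
    [0, 2, 1, 2]⟩,
  ⟨-149, 1, 0, 0, 0, 2, 0, [(-2, 0), (0, 0), (2, 0)],
    [0, 3, 2, 3]⟩,
  ⟨-149, 1, -6, 0, 0, 5, 0, [(-4, 0), (-2, 0), (2, 0), (4, 0)],
    [0, 3, 1, 1, 3]⟩,
  ⟨-149, 2, -6, 0, 0, 6, 0, [(-6, 0), (-2, 0), (2, 0), (6, 0)],
    [0, 4, 2, 2, 4]⟩,
  ⟨-1, 2, 2, 0, 0, 5, 5, [(-2, -4), (-2, 0), (-2, 4), (2, -4), (2, 0), (2, 4)],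
    [0, 3, 5, 1, 1, 5, 3]⟩,
  ⟨5, 2, -17, 1, 3, 9, 4, [(-5, -1), (-3, 1), (-1, 3), (1, -3), (3, -1), (5, 1)],
    [0, 3, 1, 5, 5, 1, 3]⟩,
  ⟨2, 1, -2, 0, 0, 4, 2, [(-2, 0), (0, -2), (0, 0), (0, 2), (2, 0)],
    [0, 3, 5, 1, 5, 3]⟩,
  ⟨-1, 1, 0, 2, 1, 4, 4, [(-2, 2), (0, -2), (0, 0), (0, 2), (2, -2)],
    [0, 2, 1, 4, 1, 2]⟩,
  ⟨-3, 1, 0, 0, 0, 2, 1, [(-2, 0), (-1, -1), (-1, 1), (0, 0), (1, -1), (1, 1), (2, 0)],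
    [0, 7, 3, 2, 4, 2, 3, 7]⟩,
  ⟨5, 1, -2, 0, 0, 4, 1, [(-2, 0), (-1, -1), (-1, 1), (0, 0), (1, -1), (1, 1), (2, 0)],
    [0, 4, 6, 5, 1, 5, 6, 4]⟩,
  ⟨-149, 1, -4, 0, 0, 4, 0, [(-4, 0), (-2, 0), (0, 0), (2, 0), (4, 0)],
    [0, 5, 2, 1, 2, 5]⟩,
  ⟨70, 12, -836, 0, 0, 55, 6, [(-36, -2), (-36, 2), (-4, -6), (-4, 6), (4, -6), (4, 6), (36,
    -2), (36, 2)],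
    [0, 4, 3, 8, 7, 7, 8, 3, 4]⟩,
  ⟨13, 1, -6, 0, 0, 5, 1, [(-4, 0), (-2, 0), (-1, -1), (-1, 1), (1, -1), (1, 1), (2, 0), (4, 0)],
    [0, 7, 1, 6, 5, 5, 6, 1, 7]⟩,
  ⟨-3, 2, 2, 0, 0, 5, 2, [(-2, 0), (0, -2), (0, 2), (2, 0)],
    [0, 4, 1, 1, 4]⟩,
  ⟨-1, 1, 0, 0, 0, 2, 2, [(-2, 0), (0, -2), (0, 0), (0, 2), (2, 0)],
    [0, 5, 1, 3, 1, 5]⟩,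
  ⟨-149, 3, -26, 0, 0, 11, 0, [(-10, 0), (-8, 0), (-2, 0), (2, 0), (8, 0), (10, 0)],
    [0, 5, 4, 2, 2, 4, 5]⟩,
  ⟨193, 12, -602, 0, 0, 49, 3, [(-46, 0), (-38, 0), (-12, -2), (-12, 2), (-10, 0), (10, 0),
    (12, -2), (12, 2), (38, 0), (46, 0)],
    [0, 9, 6, 4, 3, 1, 1, 3, 4, 6, 9]⟩,
  ⟨337, 12, -602, 0, 0, 49, 2, [(-46, 0), (-38, 0), (-12, -2), (-12, 2), (-10, 0), (10, 0),
    (12, -2), (12, 2), (38, 0), (46, 0)],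
    [0, 9, 6, 8, 7, 1, 1, 7, 8, 6, 9]⟩,
  ⟨-149, 3, -20, 0, 0, 10, 0, [(-10, 0), (-8, 0), (-4, 0), (4, 0), (8, 0), (10, 0)],
    [0, 6, 4, 3, 3, 4, 6]⟩,
  ⟨5, 1, -4, 0, 0, 4, 1, [(-4, 0), (-2, 0), (-1, -1), (-1, 1), (0, 0), (1, -1), (1, 1), (2,
    0), (4, 0)],
    [0, 9, 2, 4, 3, 1, 3, 4, 2, 9]⟩,
  ⟨33, 12, -426, 0, 0, 44, 7, [(-24, -2), (-24, 2), (-12, -2), (-12, 2), (-6, -4), (-6, 4),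
    (6, -4), (6, 4), (12, -2), (12, 2), (24, -2), (24, 2)],
    [0, 6, 5, 2, 1, 4, 3, 3, 4, 1, 2, 5, 6]⟩,
  ⟨-15, 12, -186, 0, 0, 35, 9, [(-24, -2), (-24, 2), (-12, -2), (-12, 2), (-6, -4), (-6, 4),
    (6, -4), (6, 4), (12, -2), (12, 2), (24, -2), (24, 2)],
    [0, 8, 7, 4, 3, 2, 1, 1, 2, 3, 4, 7, 8]⟩,
  ⟨-149, 4, -58, 0, 0, 16, 1, [(-14, 0), (-10, 0), (-6, 0), (-2, 0), (2, 0), (6, 0), (10, 0),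
    (14, 0)],
    [0, 7, 4, 2, 1, 1, 2, 4, 7]⟩,
  ⟨3, 1, -4, 0, 0, 4, 2, [(-4, 0), (-2, 0), (0, -2), (0, 0), (0, 2), (2, 0), (4, 0)],
    [0, 7, 2, 6, 1, 6, 2, 7]⟩,
  ⟨61, 3, -26, 0, 0, 11, 1, [(-10, 0), (-8, 0), (-3, -1), (-3, 1), (-2, 0), (2, 0), (3, -1),
    (3, 1), (8, 0), (10, 0)],
    [0, 9, 6, 8, 7, 2, 2, 7, 8, 6, 9]⟩,
  ⟨-15, 4, 6, 0, 0, 10, 2, [(-6, 0), (-4, -2), (-4, 2), (-2, 0), (0, -2), (0, 2), (2, 0), (4,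
    -2), (4, 2), (6, 0)],
    [0, 10, 3, 2, 7, 1, 1, 7, 2, 3, 10]⟩,
  ⟨2, 1, -4, 0, 0, 4, 2, [(-4, 0), (-2, 0), (0, -2), (0, 0), (0, 2), (2, 0), (4, 0)],
    [0, 7, 2, 4, 1, 4, 2, 7]⟩,
  ⟨33, 4, -26, 0, 0, 13, 2, [(-10, 0), (-6, 0), (-2, 0), (0, -2), (0, 2), (2, 0), (6, 0), (10, 0)],
    [0, 7, 3, 2, 8, 8, 2, 3, 7]⟩,
  ⟨10, 3, -26, 0, 0, 11, 3, [(-10, 0), (-8, 0), (-2, 0), (0, -2), (0, 2), (2, 0), (8, 0), (10, 0)],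
    [0, 7, 6, 2, 3, 3, 2, 6, 7]⟩,
  ⟨-15, 4, -10, 0, 0, 10, 2, [(-10, 0), (-6, 0), (-2, 0), (0, -2), (0, 2), (2, 0), (6, 0), (10, 0)],
    [0, 8, 6, 3, 1, 1, 3, 6, 8]⟩,
  ⟨41, 4, -58, 0, 0, 16, 2, [(-14, 0), (-10, 0), (-6, 0), (-2, 0), (0, -2), (0, 2), (2, 0),
    (6, 0), (10, 0), (14, 0)],
    [0, 9, 4, 2, 1, 8, 8, 1, 2, 4, 9]⟩,
  ⟨57, 4, -58, 0, 0, 16, 2, [(-14, 0), (-10, 0), (-6, 0), (-2, 0), (0, -2), (0, 2), (2, 0),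
    (6, 0), (10, 0), (14, 0)],
    [0, 9, 4, 2, 1, 10, 10, 1, 2, 4, 9]⟩,
  ⟨105, 12, -570, 0, 0, 48, 4, [(-24, -2), (-24, 2), (-12, -2), (-12, 2), (-6, -4), (-6, 4),
    (6, -4), (6, 4), (12, -2), (12, 2), (24, -2), (24, 2)],
    [0, 6, 5, 2, 1, 12, 11, 11, 12, 1, 2, 5, 6]⟩,
  ⟨17, 4, -26, 0, 0, 13, 3, [(-10, 0), (-6, 0), (-4, -2), (-4, 2), (-2, 0), (0, -2), (0, 2),
    (2, 0), (4, -2), (4, 2), (6, 0), (10, 0)],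
    [0, 11, 5, 10, 9, 2, 8, 8, 2, 9, 10, 5, 11]⟩,
  ⟨17, 4, -10, 0, 0, 10, 2, [(-10, 0), (-6, 0), (-2, 0), (0, -2), (0, 2), (2, 0), (6, 0), (10, 0)],
    [0, 8, 6, 3, 7, 7, 3, 6, 8]⟩,
  ⟨17, 4, -58, 0, 0, 16, 3, [(-14, 0), (-10, 0), (-6, 0), (-4, -2), (-4, 2), (-2, 0), (0, -2),
    (0, 2), (2, 0), (4, -2), (4, 2), (6, 0), (10, 0), (14, 0)],
    [0, 13, 6, 2, 5, 4, 1, 3, 3, 1, 4, 5, 2, 6, 13]⟩,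
  ⟨33, 4, -58, 0, 0, 16, 2, [(-14, 0), (-10, 0), (-6, 0), (-4, -2), (-4, 2), (-2, 0), (0, -2),
    (0, 2), (2, 0), (4, -2), (4, 2), (6, 0), (10, 0), (14, 0)],
    [0, 13, 6, 2, 11, 10, 1, 9, 9, 1, 10, 11, 2, 6, 13]⟩,
  ⟨-7, 4, -10, 0, 0, 10, 3, [(-10, 0), (-6, 0), (-4, -2), (-4, 2), (-2, 0), (0, -2), (0, 2),
    (2, 0), (4, -2), (4, 2), (6, 0), (10, 0)],
    [0, 12, 8, 4, 3, 5, 2, 2, 5, 3, 4, 8, 12]⟩,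
  ⟨-7, 4, -18, 8, 3, 14, 5, [(-8, 2), (-6, 0), (-4, 2), (-2, 0), (0, -2), (0, 2), (2, 0), (4,
    -2), (6, 0), (8, -2)],
    [0, 5, 6, 2, 3, 1, 1, 3, 2, 6, 5]⟩,
  ⟨73, 12, -602, 0, 0, 49, 5, [(-46, 0), (-38, 0), (-10, 0), (-6, -4), (-6, 4), (0, -2), (0,
    2), (6, -4), (6, 4), (10, 0), (38, 0), (46, 0)],
    [0, 11, 10, 1, 7, 6, 2, 2, 6, 7, 1, 10, 11]⟩,
  ⟨17, 4, -42, 0, 0, 14, 3, [(-14, 0), (-10, 0), (-6, 0), (-4, -2), (-4, 2), (-2, 0), (0, -2),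
    (0, 2), (2, 0), (4, -2), (4, 2), (6, 0), (10, 0), (14, 0)],
    [0, 14, 9, 3, 8, 7, 2, 6, 6, 2, 7, 8, 3, 9, 14]⟩,
  ⟨17, 4, -34, 8, 5, 17, 4, [(-8, 2), (-6, 0), (-4, 2), (-2, 0), (0, -2), (0, 2), (2, 0), (4,
    -2), (6, 0), (8, -2)],
    [0, 10, 3, 7, 1, 6, 6, 1, 7, 3, 10]⟩,
  ⟨-7, 4, 6, 0, 0, 10, 3, [(-6, 0), (-4, -2), (-4, 2), (-2, 0), (0, -2), (0, 2), (2, 0), (4,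
    -2), (4, 2), (6, 0)],
    [0, 10, 6, 5, 7, 4, 4, 7, 5, 6, 10]⟩,
  ⟨2, 4, -60, 0, 0, 16, 11, [(-12, -2), (-12, 2), (-4, -6), (-4, -2), (-4, 2), (-4, 6), (4,
    -6), (4, -2), (4, 2), (4, 6), (12, -2), (12, 2)],
    [0, 10, 7, 6, 2, 1, 3, 3, 1, 2, 6, 7, 10]⟩]

lemma valid_of_mem_table : ∀ c ∈ table, c.Valid := by
  decide +kernel

/-- Since the table is sorted, comparing neighbours already shows that all invariants are distinct.
-/
lemma isChain_invariant_table : (table.map invariant).IsChain (· < ·) := by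
  decide +kernel

lemma exists_mem_table_length : ∃ c ∈ table, c.pts.length = 14 := by
  decide +kernel

end Certificate

end QuadraticDynamics

open QuadraticDynamics in
theorem mainTheorem1 :
    (∀ N : ℕ,
      (∀ (K : Type) [Field K] [NumberField K] (f : K[X]),
        Module.finrank ℚ K = 2 → f.natDegree = 2 →
          (QuadraticDynamics.prePer f).encard ≤ N) →
      15 ≤ N) ∧
    (∃ (n : Fin 46 → ℕ) (G : (i : Fin 46) → Digraph (Fin (n i))),
      (∀ i, QuadraticDynamics.Arises (G i)) ∧
      (∀ i j, i ≠ j → ¬ (G i).IsIsomorphic (G j))) := by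
  refine ⟨fun N hN => ?_, ?_⟩
  · obtain ⟨c, hc, hlen⟩ := Certificate.exists_mem_table_length
    have hv := Certificate.valid_of_mem_table c hc
    have := hv.sq_ne
    have h := hN c.Fld c.poly finrank_quadraticAlgebra natDegree_X_pow_add_C
    rw [hv.prePer_encard, hlen] at h
    exact_mod_cast h
  · have hlen : Certificate.table.length = 46 := rfl
    let c : Fin 46 → Certificate := fun i => Certificate.table[i]
    refine ⟨fun i => (c i).pts.length + 1, fun i => (c i).graph,
      fun i => (Certificate.valid_of_mem_table _ (List.getElem_mem _)).arises, ?_⟩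
    intro i j hij hiso
    have hnodup : (Certificate.table.map Certificate.invariant).Nodup :=
      Certificate.isChain_invariant_table.pairwise.imp fun h => h.ne
    have hinv := Certificate.invariant_eq_of_isIsomorphic hiso
    refine hij (Fin.ext ((hnodup.getElem_inj_iff (hi := by simp [hlen])
      (hj := by simp [hlen])).1 ?_))
    rw [List.getElem_map, List.getElem_map]
    exact hinv
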